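/- Call a subgroup $L\subset\mathbb Z^2$ a valid lattice if it is generated by two linearly independent vectors, each of which has two coordinates of the same parity. A tiling $t$ of the torus $\mathbb T_L=\mathbb R^2/L$ is an $L$-periodic domino tiling of the infinite square lattice. It admits a flip if two parallel dominoes of $t$ form a $2\times2$ square. Colour the unit squares black and white alternately with $[0,1]^2$ black, and orient every edge of the square lattice clockwise around the black square that it bounds. The height function of $t$ is the function $h_t:\mathbb Z^2\to\mathbb Z$ with $h_t(0)=0$ such that, for every oriented edge from $u$ to $w$, $h_t(w)=h_t(u)+1$ if the edge does not cross a domino of $t$, and $h_t(w)=h_t(u)-3$ if it does. The flux of $t$ is the vector $\varphi_t\in\mathbb R^2$ with $\langle\varphi_t,v\rangle=\tfrac14\big(h_t(w+v)-h_t(w)\big)$ for all $v\in L$ and $w\in\mathbb Z^2$. Let $Q=\{(x,y)\in\mathbb R^2:|x|+|y|\le\tfrac12\}$. A doubly-infinite domino staircase is a sequence $(s_n)_{n\in\mathbb Z}$ of dominoes, all horizontal or all vertical, such that the neighbours of $s_n$ in the sequence (the other dominoes of the sequence that share at least one unit edge with it) are exactly $s_{n-1}$ and $s_{n+1}$; each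 of these two touches $s_n$ along exactly one unit edge, which lies on the longer side of $s_n$; and they touch $s_n$ at different squares. Such a staircase runs either northeast-southwest or northwest-southeast; staircases are parallel if they run in the same direction. **Proposition.** Let $L$ be a valid lattice and $t$ a tiling of $\mathbb T_L$. Then the flux $\varphi_t$ exists and is unique, and the following are equivalent: 1. $t$ admits no flips; 2. $\varphi_t\in\partial Q$; 3. $t$ consists entirely of parallel doubly-infinite domino staircases, that is, every domino of $t$ belongs to a doubly-infinite domino staircase made of dominoes of $t$, and these staircases can be chosen pairwise parallel. -/

import Mathlib

/-! Unit squares of the plane are labelled by their lower left corner: `(x, y) : ℤ × ℤ` stands for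
the square `[x, x+1] × [y, y+1]`. Vertices of squares are also elements of `ℤ × ℤ`.
The square `(x, y)` is black if `x + y` is even, so that `[0,1]²` is black. -/

/-- A domino: the union of the unit square `corner` and its right neighbour (horizontal domino)
or its upper neighbour (vertical domino). -/
@[ext]
structure Domino where
  corner : ℤ × ℤ
  horizontal : Bool

namespace Domino

/-- The horizontal domino whose left square is `(x, y)`. -/
def hor (x y : ℤ) : Domino := ⟨(x, y), true⟩

/-- The vertical domino whose lower square is `(x, y)`. -/
def ver (x y : ℤ) : Domino := ⟨(x, y), false⟩

/-- The two unit squares of a domino. -/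
def squares (d : Domino) : Set (ℤ × ℤ) :=
  {d.corner, if d.horizontal then d.corner + (1, 0) else d.corner + (0, 1)}

def translate (d : Domino) (v : ℤ × ℤ) : Domino := ⟨d.corner + v, d.horizontal⟩

end Domino

/-- A domino tiling of the infinite square lattice: every unit square lies in exactly one domino. -/
def IsTiling (t : Set Domino) : Prop :=
  ∀ c : ℤ × ℤ, ∃! d : Domino, d ∈ t ∧ c ∈ d.squares

/-- Both coordinates of `v` are even or both are odd. -/
def SameParity (v : ℤ × ℤ) : Prop :=
  (Even v.1 ∧ Even v.2) ∨ (Odd v.1 ∧ Odd v.2)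

/-- A valid lattice: generated by two linearly independent integral vectors, each of which has
coordinates of the same parity. -/
def IsValidLattice (L : AddSubgroup (ℤ × ℤ)) : Prop :=
  ∃ v₀ v₁ : ℤ × ℤ, L = AddSubgroup.closure {v₀, v₁} ∧
    v₀.1 * v₁.2 - v₀.2 * v₁.1 ≠ 0 ∧ SameParity v₀ ∧ SameParity v₁

/-- A tiling of the torus `ℝ² / L` is an `L`-periodic tiling of the infinite square lattice. -/
def IsTorusTiling (L : AddSubgroup (ℤ × ℤ)) (t : Set Domino) : Prop :=
  IsTiling t ∧ ∀ v ∈ L, ∀ d ∈ t, d.translate v ∈ t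

/-- Two parallel dominoes of `t` form a `2 × 2` square. -/
def AdmitsFlip (t : Set Domino) : Prop :=
  ∃ x y : ℤ, (Domino.hor x y ∈ t ∧ Domino.hor x (y + 1) ∈ t) ∨
    (Domino.ver x y ∈ t ∧ Domino.ver (x + 1) y ∈ t)

open Classical in
/-- The change of a height function along a correctly oriented edge, where `d` is the domino
formed by the two squares on the two sides of that edge: `-3` if the edge crosses a domino of the
tiling (which is then `d`), and `+1` if it does not. -/
noncomputable def edgeStep (t : Set Domino) (d : Domino) : ℤ :=
  if d ∈ t then -3 else 1

/-- `h` is the height function of `t` with value `0` at the origin. Edges are oriented clockwise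
around black squares; every edge lies on exactly one black square, and the four conditions are
those for the left, upper, right and lower edge of the black square `(x, y)`. -/
def IsHeightFunction (t : Set Domino) (h : ℤ × ℤ → ℤ) : Prop :=
  h (0, 0) = 0 ∧ ∀ x y : ℤ, Even (x + y) →
    h (x, y + 1) = h (x, y) + edgeStep t (Domino.hor (x - 1) y) ∧
    h (x + 1, y + 1) = h (x, y + 1) + edgeStep t (Domino.ver x y) ∧
    h (x + 1, y) = h (x + 1, y + 1) + edgeStep t (Domino.hor x y) ∧
    h (x, y) = h (x + 1, y) + edgeStep t (Domino.ver x (y - 1))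

/-- `φ ∈ ℝ²` is the flux of the tiling `t` of `ℝ² / L`: under the usual inner product it represents
the homomorphism on `L` given by `v ↦ (h (w + v) - h w) / 4` for every vertex `w`, where `h` is
the height function of `t`. -/
def IsFlux (L : AddSubgroup (ℤ × ℤ)) (t : Set Domino) (φ : ℝ × ℝ) : Prop :=
  ∃ h : ℤ × ℤ → ℤ, IsHeightFunction t h ∧
    ∀ v ∈ L, ∀ w : ℤ × ℤ,
      φ.1 * (v.1 : ℝ) + φ.2 * (v.2 : ℝ) = ((h (w + v) : ℝ) - (h w : ℝ)) / 4

/-- The filled square with vertices `(± 1/2, 0)` and `(0, ± 1/2)`. -/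
def fluxSquare : Set (ℝ × ℝ) := {p | |p.1| + |p.2| ≤ 1 / 2}

/-- The square `a` of `d` and the square `b` of `e` share an edge. -/
def TouchAt (d e : Domino) (a b : ℤ × ℤ) : Prop :=
  a ∈ d.squares ∧ b ∈ e.squares ∧ |a.1 - b.1| + |a.2 - b.2| = 1

/-- Distinct dominoes that touch along at least one edge. -/
def Neighbouring (d e : Domino) : Prop :=
  d ≠ e ∧ ∃ a b : ℤ × ℤ, TouchAt d e a b

/-- `d` and `e` touch along exactly one edge, and it lies on the longer side of `d`. -/
def TouchAlongLongerSide (d e : Domino) : Prop :=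
  ∃ a b : ℤ × ℤ, (∀ a' b' : ℤ × ℤ, TouchAt d e a' b' ↔ a' = a ∧ b' = b) ∧
    (if d.horizontal then a.1 = b.1 else a.2 = b.2)

/-- A doubly-infinite domino staircase, as a sequence of dominoes indexed by `ℤ`. -/
structure IsStaircase (s : ℤ → Domino) : Prop where
  same_orientation : ∀ m n : ℤ, (s m).horizontal = (s n).horizontal
  /-- Each domino has exactly two neighbouring dominoes in the sequence: the preceding one and
  the next one. -/
  neighbours : ∀ m n : ℤ, Neighbouring (s m) (s n) ↔ n = m + 1 ∨ n = m - 1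
  longer_side : ∀ m n : ℤ, Neighbouring (s m) (s n) → TouchAlongLongerSide (s m) (s n)
  /-- The two neighbours of a domino touch it at different squares. -/
  different_squares : ∀ n : ℤ, ∀ a b a' b' : ℤ × ℤ,
    TouchAt (s n) (s (n + 1)) a b → TouchAt (s n) (s (n - 1)) a' b' → a ≠ a'

/-- Two staircases run in the same direction (both northeast-southwest or both
northwest-southeast): their steps are collinear vectors. -/
def ParallelStaircases (s s' : ℤ → Domino) : Prop :=
  ∀ m n : ℤ,
    ((s (m + 1)).corner.1 - (s m).corner.1) * ((s' (n + 1)).corner.2 - (s' n).corner.2) =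
    ((s (m + 1)).corner.2 - (s m).corner.2) * ((s' (n + 1)).corner.1 - (s' n).corner.1)

/-- `t` consists entirely of parallel, doubly-infinite domino staircases. -/
def ConsistsOfParallelStaircases (t : Set Domino) : Prop :=
  ∃ S : Set (ℤ → Domino),
    (∀ s ∈ S, IsStaircase s ∧ ∀ n : ℤ, s n ∈ t) ∧
    (∀ s ∈ S, ∀ s' ∈ S, ParallelStaircases s s') ∧
    (∀ d ∈ t, ∃ s ∈ S, ∃ n : ℤ, s n = d)

/-!
The proof rests on the height function along diagonal zigzags. The oriented edges leave a vertex
`(x, y)` vertically if `x + y` is even and horizontally if `x + y` is odd, so an oriented edge path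
alternates between vertical and horizontal edges, and `2n` edges of it can join `p` to
`p + n • (ε₁, ε₂)`, where `ε₁, ε₂ = ±1`. The height increases by at most `1` along each of its
edges, with equality exactly at the edges that are not crossed by a domino.

*Existence of the flux.* Every unit square has exactly one crossed side
(`IsTiling.sum_edgeStep`), so the prescribed height changes are consistent and the height function
`h` exists and is unique. By periodicity `h (w + v) - h w` does not depend on `w` for `v ∈ L`
(`IsTorusTiling.height_add`), hence is additive in `v`, and the flux is the solution of the two
linear equations given by the generators of `L`.

*The flux lies in the square.* As `L` contains `N • ℤ²` for some `N > 0`, the bound on zigzags of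
`2N` edges gives `φ.1 * ε₁ + φ.2 * ε₂ ≤ 1 / 2` for all signs, that is `|φ.1| + |φ.2| ≤ 1 / 2`. If
equality holds for some signs, every zigzag in that direction has only uncrossed edges
(`flux_diagonal_le`). This excludes flips (`UncrossedTowards.not_admitsFlip`), because a flip is
a vertex at which two opposite edges are crossed. It also fixes the colour pattern of the dominoes
so rigidly that each domino has its two translates by `±(ε₁, ε₂)` in the tiling
(`UncrossedTowards.translate_mem`), and the tiling is made of staircases in direction `(ε₁, ε₂)`.

*Without flips the flux is on the boundary.* Without flips every vertex has an uncrossed outgoing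
edge, so there is a path of `2n` uncrossed edges starting at the origin; it ends at height `2n`, at
a vertex with both coordinates at most `n` in absolute value (`IsHeightFunction.exists_ascending`).
Since `h` stays within a bounded distance of the linear function `4 φ`, letting `n` grow gives
`|φ.1| + |φ.2| ≥ 1 / 2` (`flux_abs_add_abs_ge`).

*Staircases exclude flips.* A staircase is straight at each of its dominoes, and the two diagonal
neighbours of a domino overlap any domino that could form a flip with it.
-/

/-! ### Dominoes and tilings -/

namespace Domino

theorem mem_squares_hor {x y : ℤ} {c : ℤ × ℤ} :
    c ∈ (hor x y).squares ↔ c = (x, y) ∨ c = (x + 1, y) := by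
  simp [hor, squares]

theorem mem_squares_ver {x y : ℤ} {c : ℤ × ℤ} :
    c ∈ (ver x y).squares ↔ c = (x, y) ∨ c = (x, y + 1) := by
  simp [ver, squares]

theorem eq_hor_or_ver (d : Domino) :
    d = hor d.corner.1 d.corner.2 ∨ d = ver d.corner.1 d.corner.2 := by
  rcases d with ⟨⟨x, y⟩, _ | _⟩ <;> simp [hor, ver]

theorem hor_inj {x y x' y' : ℤ} : hor x y = hor x' y' ↔ x = x' ∧ y = y' := by
  simp [hor]

theorem ver_inj {x y x' y' : ℤ} : ver x y = ver x' y' ↔ x = x' ∧ y = y' := by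
  simp [ver]

theorem hor_ne_ver {x y x' y' : ℤ} : hor x y ≠ ver x' y' := by
  simp [hor, ver]

theorem translate_zero (d : Domino) : d.translate (0, 0) = d := by
  rcases d with ⟨⟨x, y⟩, o⟩
  simp [translate]

theorem translate_hor (x y : ℤ) (v : ℤ × ℤ) :
    (hor x y).translate v = hor (x + v.1) (y + v.2) := rfl

theorem translate_ver (x y : ℤ) (v : ℤ × ℤ) :
    (ver x y).translate v = ver (x + v.1) (y + v.2) := rfl

end Domino

open Domino

namespace IsTiling

variable {t : Set Domino}

theorem eq_of_mem_squares (ht : IsTiling t) {d e : Domino} (hd : d ∈ t) (he : e ∈ t)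
    {c : ℤ × ℤ} (hcd : c ∈ d.squares) (hce : c ∈ e.squares) : d = e :=
  (ht c).unique ⟨hd, hcd⟩ ⟨he, hce⟩

/-- One of the four dominoes containing a given square is in the tiling. -/
theorem cover (ht : IsTiling t) (x y : ℤ) :
    hor x y ∈ t ∨ hor (x - 1) y ∈ t ∨ ver x y ∈ t ∨ ver x (y - 1) ∈ t := by
  obtain ⟨d, ⟨hd, hc⟩, -⟩ := ht (x, y)
  rcases d.eq_hor_or_ver with h | h <;> rw [h] at hc hd
  · rcases mem_squares_hor.1 hc with h | h <;> simp only [Prod.mk.injEq] at h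
    · rw [← h.1, ← h.2] at hd; exact .inl hd
    · rw [← h.2, show d.corner.1 = x - 1 by omega] at hd; exact .inr (.inl hd)
  · rcases mem_squares_ver.1 hc with h | h <;> simp only [Prod.mk.injEq] at h
    · rw [← h.1, ← h.2] at hd; exact .inr (.inr (.inl hd))
    · rw [← h.1, show d.corner.2 = y - 1 by omega] at hd; exact .inr (.inr (.inr hd))

theorem not_hor_hor (ht : IsTiling t) {x y x' : ℤ} (h : hor x y ∈ t) (h' : hor x' y ∈ t) :
    x' ≠ x + 1 := by
  rintro rfl
  have := ht.eq_of_mem_squares h h' (c := (x + 1, y)) (by simp [mem_squares_hor])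
    (by simp [mem_squares_hor])
  simp [hor_inj] at this

theorem not_ver_ver (ht : IsTiling t) {x y y' : ℤ} (h : ver x y ∈ t) (h' : ver x y' ∈ t) :
    y' ≠ y + 1 := by
  rintro rfl
  have := ht.eq_of_mem_squares h h' (c := (x, y + 1)) (by simp [mem_squares_ver])
    (by simp [mem_squares_ver])
  simp [ver_inj] at this

theorem not_hor_ver (ht : IsTiling t) {x y x' y' : ℤ} (h : hor x y ∈ t) (h' : ver x' y' ∈ t) :
    ¬ ((x' = x ∨ x' = x + 1) ∧ (y = y' ∨ y = y' + 1)) := by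
  rintro ⟨h1, h2⟩
  refine hor_ne_ver (ht.eq_of_mem_squares h h' (c := (x', y)) ?_ ?_)
  · rw [mem_squares_hor]; rcases h1 with rfl | rfl <;> simp
  · rw [mem_squares_ver]; rcases h2 with rfl | rfl <;> simp

/-- Exactly one side of a unit square is crossed by a domino, so that the changes of height along
its four sides, all oriented clockwise or all counterclockwise, add up to `0`. -/
theorem sum_edgeStep (ht : IsTiling t) (x y : ℤ) :
    edgeStep t (hor x y) + edgeStep t (hor (x - 1) y) + edgeStep t (ver x y)
      + edgeStep t (ver x (y - 1)) = 0 := by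
  have c := ht.cover x y
  have h1 : hor (x - 1) y ∈ t → hor x y ∉ t := fun h h' => ht.not_hor_hor h h' (by ring)
  have h2 : ver x (y - 1) ∈ t → ver x y ∉ t := fun h h' => ht.not_ver_ver h h' (by ring)
  have h3 : hor x y ∈ t → ver x y ∉ t := fun h h' => ht.not_hor_ver h h' (by simp)
  have h4 : hor x y ∈ t → ver x (y - 1) ∉ t := fun h h' => ht.not_hor_ver h h' (by simp)
  have h5 : hor (x - 1) y ∈ t → ver x y ∉ t := fun h h' => ht.not_hor_ver h h' (by simp)
  have h6 : hor (x - 1) y ∈ t → ver x (y - 1) ∉ t := fun h h' => ht.not_hor_ver h h' (by simp)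
  rcases c with c | c | c | c <;> grind [edgeStep]

end IsTiling

/-! ### Height functions -/

/-- A function on `ℤ` with prescribed differences. -/
theorem exists_eq_add_of_int (g : ℤ → ℤ) :
    ∃ f : ℤ → ℤ, f 0 = 0 ∧ ∀ n, f (n + 1) = f n + g n := by
  refine ⟨fun n => ∑ i ∈ Finset.Ico 0 n, g i - ∑ i ∈ Finset.Ico n 0, g i, by simp, fun n => ?_⟩
  dsimp only
  rcases lt_or_ge n 0 with hn | hn
  · have h1 : Finset.Ico 0 n = ∅ := by ext; simp; omega
    have h2 : Finset.Ico 0 (n + 1) = ∅ := by ext; simp; omega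
    have h3 : Finset.Ico n 0 = insert n (Finset.Ico (n + 1) 0) := by ext; simp; omega
    rw [h1, h2, h3, Finset.sum_insert (by simp)]
    simp
  · have h1 : Finset.Ico n 0 = ∅ := by ext; simp; omega
    have h2 : Finset.Ico (n + 1) 0 = ∅ := by ext; simp; omega
    have h3 : Finset.Ico 0 (n + 1) = insert n (Finset.Ico 0 n) := by ext; simp; omega
    rw [h1, h2, h3, Finset.sum_insert (by simp)]
    simp [add_comm]

/-- A function on `ℤ × ℤ` that is invariant under both unit steps is constant. -/
theorem eq_apply_zero_of_step {f : ℤ × ℤ → ℤ}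
    (h1 : ∀ x y, f (x + 1, y) = f (x, y)) (h2 : ∀ x y, f (x, y + 1) = f (x, y)) (p : ℤ × ℤ) :
    f p = f (0, 0) := by
  obtain ⟨x, y⟩ := p
  have hx : f (x, y) = f (0, y) := by
    induction x using Int.induction_on with
    | zero => rfl
    | succ i ih => rw [h1, ih]
    | pred i ih => rw [← ih, ← h1, sub_add_cancel]
  rw [hx]
  clear hx
  induction y using Int.induction_on with
  | zero => rfl
  | succ i ih => rw [h2, ih]
  | pred i ih => rw [← ih, ← h2, sub_add_cancel]

open Classical in
/-- The change of height along the edge from `(x, y)` to `(x + 1, y)`, which points to the right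
exactly when `x + y` is odd. -/
noncomputable def rightStep (t : Set Domino) (x y : ℤ) : ℤ :=
  if Even (x + y) then -edgeStep t (ver x (y - 1)) else edgeStep t (ver x (y - 1))

open Classical in
/-- The change of height along the edge from `(x, y)` to `(x, y + 1)`, which points upwards
exactly when `x + y` is even. -/
noncomputable def upStep (t : Set Domino) (x y : ℤ) : ℤ :=
  if Even (x + y) then edgeStep t (hor (x - 1) y) else -edgeStep t (hor (x - 1) y)

theorem isHeightFunction_iff {t : Set Domino} {h : ℤ × ℤ → ℤ} :
    IsHeightFunction t h ↔ h (0, 0) = 0 ∧ ∀ x y : ℤ,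
      h (x + 1, y) = h (x, y) + rightStep t x y ∧ h (x, y + 1) = h (x, y) + upStep t x y := by
  unfold IsHeightFunction rightStep upStep
  refine and_congr_right fun _ => ⟨fun H x y => ?_, fun H x y hxy => ?_⟩
  · by_cases hxy : Even (x + y)
    · have := H x y hxy
      simp only [hxy, if_true]
      omega
    · have a := (H x (y - 1) (by grind)).2.1
      have b := (H (x - 1) y (by grind)).2.2.1
      simp only [sub_add_cancel] at a b
      simp only [hxy, if_false]
      omega
  · have a := H x y
    have b := (H (x + 1) y).2
    have c := (H x (y + 1)).1
    simp only [hxy, if_true] at a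
    rw [if_neg (by grind)] at b c
    simp only [add_sub_cancel_right] at b c
    omega

theorem IsTiling.exists_isHeightFunction {t : Set Domino} (ht : IsTiling t) :
    ∃ h, IsHeightFunction t h := by
  obtain ⟨f, f0, hf⟩ := exists_eq_add_of_int fun x => rightStep t x 0
  choose g g0 hg using fun x => exists_eq_add_of_int fun y => upStep t x y
  have face (x y : ℤ) :
      rightStep t x y + upStep t (x + 1) y = upStep t x y + rightStep t x (y + 1) := by
    have := ht.sum_edgeStep x y
    unfold rightStep upStep
    by_cases hxy : Even (x + y)
    · rw [if_pos hxy, if_pos hxy, if_neg (by grind), if_neg (by grind)]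
      simp only [add_sub_cancel_right]; omega
    · rw [if_neg hxy, if_neg hxy, if_pos (by grind), if_pos (by grind)]
      simp only [add_sub_cancel_right]; omega
  refine ⟨fun p => f p.1 + g p.1 p.2, isHeightFunction_iff.2 ⟨by simp [f0, g0], fun x y => ?_⟩⟩
  dsimp only
  refine ⟨?_, by rw [hg]; ring⟩
  induction y using Int.induction_on with
  | zero => simp [g0, hf]
  | succ i ih =>
    have := face x i
    rw [hg, hg]; omega
  | pred i ih =>
    have := face x (-i - 1)
    have a := hg x (-i - 1)
    have b := hg (x + 1) (-i - 1)
    simp only [sub_add_cancel] at this a b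
    omega

theorem IsHeightFunction.unique {t : Set Domino} {h h' : ℤ × ℤ → ℤ}
    (hh : IsHeightFunction t h) (hh' : IsHeightFunction t h') : h = h' := by
  rw [isHeightFunction_iff] at hh hh'
  funext p
  have := eq_apply_zero_of_step (f := fun p => h p - h' p)
    (fun x y => by have := hh.2 x y; have := hh'.2 x y; omega)
    (fun x y => by have := hh.2 x y; have := hh'.2 x y; omega) p
  simp only [hh.1, hh'.1] at this
  omega

/-! ### The flux -/

theorem IsValidLattice.even_add {L : AddSubgroup (ℤ × ℤ)} (hL : IsValidLattice L) {v : ℤ × ℤ}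
    (hv : v ∈ L) : Even (v.1 + v.2) := by
  obtain ⟨v₀, v₁, rfl, -, h0, h1⟩ := hL
  unfold SameParity at h0 h1
  induction hv using AddSubgroup.closure_induction with
  | mem x hx => rcases hx with rfl | rfl <;> grind
  | zero => simp
  | add x y _ _ hx hy => simp only [Prod.fst_add, Prod.snd_add]; grind
  | neg x _ hx => simp only [Prod.fst_neg, Prod.snd_neg]; grind

/-- A valid lattice has a positive multiple of `ℤ²` as a subgroup: the absolute value of the
determinant of a basis is a possible factor. -/
theorem IsValidLattice.exists_mul_mem {L : AddSubgroup (ℤ × ℤ)} (hL : IsValidLattice L) :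
    ∃ N : ℕ, 0 < N ∧ ∀ x y : ℤ, ((N * x, N * y) : ℤ × ℤ) ∈ L := by
  obtain ⟨v₀, v₁, rfl, hD, -, -⟩ := hL
  have key (x y : ℤ) : (((v₀.1 * v₁.2 - v₀.2 * v₁.1) * x, (v₀.1 * v₁.2 - v₀.2 * v₁.1) * y) : ℤ × ℤ)
      ∈ AddSubgroup.closure {v₀, v₁} := by
    have h0 : v₀ ∈ AddSubgroup.closure {v₀, v₁} := AddSubgroup.subset_closure (by simp)
    have h1 : v₁ ∈ AddSubgroup.closure {v₀, v₁} := AddSubgroup.subset_closure (by simp)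
    convert add_mem (zsmul_mem h0 (v₁.2 * x - v₁.1 * y)) (zsmul_mem h1 (v₀.1 * y - v₀.2 * x))
      using 1
    ext <;> simp <;> ring
  refine ⟨(v₀.1 * v₁.2 - v₀.2 * v₁.1).natAbs, Int.natAbs_pos.2 hD, fun x y => ?_⟩
  rcases Int.natAbs_eq (v₀.1 * v₁.2 - v₀.2 * v₁.1) with h | h
  · rw [← h]; exact key x y
  · have := key (-x) (-y)
    rw [h] at this
    simpa using this

theorem IsTorusTiling.translate_mem_iff {L : AddSubgroup (ℤ × ℤ)} {t : Set Domino}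
    (ht : IsTorusTiling L t) {v : ℤ × ℤ} (hv : v ∈ L) (d : Domino) :
    d.translate v ∈ t ↔ d ∈ t := by
  refine ⟨fun h => ?_, ht.2 v hv d⟩
  have := ht.2 (-v) (neg_mem hv) _ h
  simpa [Domino.translate] using this

/-- The height difference between a vertex and its translate by a vector of the lattice does not
depend on the vertex. -/
theorem IsTorusTiling.height_add {L : AddSubgroup (ℤ × ℤ)} (hL : IsValidLattice L)
    {t : Set Domino} (ht : IsTorusTiling L t) {h : ℤ × ℤ → ℤ} (hh : IsHeightFunction t h)
    {v : ℤ × ℤ} (hv : v ∈ L) (w : ℤ × ℤ) : h (w + v) = h w + h v := by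
  have hh' := isHeightFunction_iff.1 hh
  have E := hL.even_add hv
  have par (x y : ℤ) : Even (x + v.1 + (y + v.2)) ↔ Even (x + y) := by grind
  have st (d : Domino) : edgeStep t (d.translate v) = edgeStep t d := by
    have := ht.translate_mem_iff hv d
    by_cases hd : d ∈ t <;> simp_all [edgeStep]
  have R (x y : ℤ) : rightStep t (x + v.1) (y + v.2) = rightStep t x y := by
    have := st (ver x (y - 1))
    rw [translate_ver, sub_add_eq_add_sub] at this
    simp only [rightStep, par, this]
  have U (x y : ℤ) : upStep t (x + v.1) (y + v.2) = upStep t x y := by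
    have := st (hor (x - 1) y)
    rw [translate_hor, sub_add_eq_add_sub] at this
    simp only [upStep, par, this]
  have := eq_apply_zero_of_step (f := fun p => h (p + v) - h p)
    (fun x y => by
      have a := (hh'.2 x y).1
      have b := (hh'.2 (x + v.1) (y + v.2)).1
      rw [R, add_right_comm] at b
      simp only [Prod.add_def]; omega)
    (fun x y => by
      have a := (hh'.2 x y).2
      have b := (hh'.2 (x + v.1) (y + v.2)).2
      rw [U, add_right_comm] at b
      simp only [Prod.add_def]; omega) w
  have z : ((0, 0) : ℤ × ℤ) + v = v := zero_add v
  simp only [z, hh.1] at this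
  omega

theorem existsUnique_isFlux {L : AddSubgroup (ℤ × ℤ)} (hL : IsValidLattice L)
    {t : Set Domino} (ht : IsTorusTiling L t) : ∃! φ : ℝ × ℝ, IsFlux L t φ := by
  obtain ⟨h, hh⟩ := ht.1.exists_isHeightFunction
  have hadd {v : ℤ × ℤ} (hv : v ∈ L) := ht.height_add hL hh hv
  have h00 : h 0 = 0 := hh.1
  have hflux (φ : ℝ × ℝ) : IsFlux L t φ ↔ ∀ v ∈ L, φ.1 * v.1 + φ.2 * v.2 = (h v : ℝ) / 4 := by
    constructor
    · rintro ⟨h', hh', H⟩ v hv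
      obtain rfl := hh.unique hh'
      simpa [h00] using H v hv 0
    · refine fun H => ⟨h, hh, fun v hv w => ?_⟩
      rw [H v hv, hadd hv]
      push_cast; ring
  obtain ⟨v₀, v₁, rfl, hD, -, -⟩ := id hL
  have m0 : v₀ ∈ AddSubgroup.closure {v₀, v₁} := AddSubgroup.subset_closure (by simp)
  have m1 : v₁ ∈ AddSubgroup.closure {v₀, v₁} := AddSubgroup.subset_closure (by simp)
  have hD' : (v₀.1 * v₁.2 - v₀.2 * v₁.1 : ℝ) ≠ 0 := by exact_mod_cast hD
  set D : ℝ := v₀.1 * v₁.2 - v₀.2 * v₁.1 with hDdef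
  -- The two equations given by the generators are solved by Cramer's rule.
  refine ⟨((h v₀ / 4 * v₁.2 - h v₁ / 4 * v₀.2) / D, (v₀.1 * (h v₁ / 4) - v₁.1 * (h v₀ / 4)) / D),
    (hflux _).2 fun v hv => ?_, fun φ hφ => ?_⟩
  · dsimp only
    induction hv using AddSubgroup.closure_induction with
    | mem x hx => rcases hx with rfl | rfl <;> field_simp <;> rw [hDdef] <;> ring
    | zero => simp [h00]
    | add x y hx hy ihx ihy =>
      rw [hadd hy x, Prod.fst_add, Prod.snd_add]
      push_cast
      linear_combination ihx + ihy
    | neg x hx ihx =>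
      have := hadd hx (-x)
      rw [neg_add_cancel, h00] at this
      rw [show h (-x) = -h x by omega, Prod.fst_neg, Prod.snd_neg]
      push_cast
      linear_combination -ihx
  · have e0 := (hflux φ).1 hφ v₀ m0
    have e1 := (hflux φ).1 hφ v₁ m1
    ext
    · rw [eq_div_iff hD', ← e0, ← e1, hDdef]; ring
    · rw [eq_div_iff hD', ← e0, ← e1, hDdef]; ring

/-! ### Ascending zigzags -/

/-- No edge with a component in the direction `(ε₁, ε₂)`, where `ε₁, ε₂ = ±1`, is crossed by a
domino. The oriented edges leave a vertex `(x, y)` vertically if `x + y` is even, and horizontally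
if `x + y` is odd; hence all horizontal edges in question start at odd vertices, and all vertical
ones at even vertices. -/
def UncrossedTowards (t : Set Domino) (ε₁ ε₂ : ℤ) : Prop :=
  (∀ x y : ℤ, Even (x + y) → hor (x - 1) (min y (y + ε₂)) ∉ t) ∧
    ∀ x y : ℤ, ¬ Even (x + y) → ver (min x (x + ε₁)) (y - 1) ∉ t

theorem edgeStep_le_one (t : Set Domino) (d : Domino) : edgeStep t d ≤ 1 := by
  unfold edgeStep; split_ifs <;> norm_num

theorem edgeStep_eq_one_iff {t : Set Domino} {d : Domino} : edgeStep t d = 1 ↔ d ∉ t := by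
  unfold edgeStep; split_ifs with h <;> simp [h]

namespace IsHeightFunction

variable {t : Set Domino} {h : ℤ × ℤ → ℤ}

theorem vertical_step (hh : IsHeightFunction t h) {ε : ℤ} (hε : ε = 1 ∨ ε = -1) {x y : ℤ}
    (hxy : Even (x + y)) :
    h (x, y + ε) = h (x, y) + edgeStep t (hor (x - 1) (min y (y + ε))) := by
  rcases hε with rfl | rfl
  · rw [min_eq_left (by omega)]
    exact (hh.2 x y hxy).1
  · rw [min_eq_right (by omega), ← sub_eq_add_neg]
    simpa using (hh.2 (x - 1) (y - 1) (by grind)).2.2.1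

theorem horizontal_step (hh : IsHeightFunction t h) {ε : ℤ} (hε : ε = 1 ∨ ε = -1) {x y : ℤ}
    (hxy : ¬ Even (x + y)) :
    h (x + ε, y) = h (x, y) + edgeStep t (ver (min x (x + ε)) (y - 1)) := by
  rcases hε with rfl | rfl
  · rw [min_eq_left (by omega)]
    simpa using (hh.2 x (y - 1) (by grind)).2.1
  · rw [min_eq_right (by omega), ← sub_eq_add_neg]
    simpa using (hh.2 (x - 1) y (by grind)).2.2.2

/-- The height along a zigzag of two oriented edges, the first of which is vertical. -/
theorem diagonal_step (hh : IsHeightFunction t h) {ε₁ ε₂ : ℤ} (h₁ : ε₁ = 1 ∨ ε₁ = -1)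
    (h₂ : ε₂ = 1 ∨ ε₂ = -1) {x y : ℤ} (hxy : Even (x + y)) :
    h (x + ε₁, y + ε₂) = h (x, y) + edgeStep t (hor (x - 1) (min y (y + ε₂)))
      + edgeStep t (ver (min x (x + ε₁)) (y + ε₂ - 1)) := by
  rw [hh.horizontal_step h₁ (by rcases h₂ with rfl | rfl <;> grind), hh.vertical_step h₂ hxy]

theorem diagonal_le (hh : IsHeightFunction t h) {ε₁ ε₂ : ℤ} (h₁ : ε₁ = 1 ∨ ε₁ = -1)
    (h₂ : ε₂ = 1 ∨ ε₂ = -1) {x y : ℤ} (hxy : Even (x + y)) (n : ℕ) :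
    h (x + n * ε₁, y + n * ε₂) ≤ h (x, y) + 2 * n := by
  induction n with
  | zero => simp
  | succ n ih =>
    have e : Even (x + n * ε₁ + (y + n * ε₂)) := by
      rcases h₁ with rfl | rfl <;> rcases h₂ with rfl | rfl <;> grind
    have := hh.diagonal_step h₁ h₂ e
    have a := edgeStep_le_one t (hor (x + n * ε₁ - 1) (min (y + n * ε₂) (y + n * ε₂ + ε₂)))
    have b := edgeStep_le_one t (ver (min (x + n * ε₁) (x + n * ε₁ + ε₁)) (y + n * ε₂ + ε₂ - 1))
    push_cast
    rw [show x + (n + 1) * ε₁ = x + n * ε₁ + ε₁ by ring,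
      show y + (n + 1) * ε₂ = y + n * ε₂ + ε₂ by ring]
    omega

/-- If every zigzag of `2N` edges in the direction `(ε₁, ε₂)` attains the greatest possible
increase of height, then none of its edges is crossed. -/
theorem uncrossedTowards (hh : IsHeightFunction t h) {ε₁ ε₂ : ℤ} (h₁ : ε₁ = 1 ∨ ε₁ = -1)
    (h₂ : ε₂ = 1 ∨ ε₂ = -1) {N : ℕ} (hN : 0 < N)
    (H : ∀ x y : ℤ, h (x + N * ε₁, y + N * ε₂) = h (x, y) + 2 * N) :
    UncrossedTowards t ε₁ ε₂ := by
  have key (x y : ℤ) (hxy : Even (x + y)) : hor (x - 1) (min y (y + ε₂)) ∉ t ∧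
      ver (min x (x + ε₁)) (y + ε₂ - 1) ∉ t := by
    obtain ⟨n, rfl⟩ : ∃ n, N = n + 1 := ⟨N - 1, by omega⟩
    have e : Even (x + ε₁ + (y + ε₂)) := by
      rcases h₁ with rfl | rfl <;> rcases h₂ with rfl | rfl <;> grind
    have c := hh.diagonal_le h₁ h₂ e n
    have d := hh.diagonal_step h₁ h₂ hxy
    have a := edgeStep_le_one t (hor (x - 1) (min y (y + ε₂)))
    have b := edgeStep_le_one t (ver (min x (x + ε₁)) (y + ε₂ - 1))
    have H' := H x y
    push_cast at H'
    rw [show x + (n + 1) * ε₁ = x + ε₁ + n * ε₁ by ring,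
      show y + (n + 1) * ε₂ = y + ε₂ + n * ε₂ by ring] at H'
    rw [← edgeStep_eq_one_iff, ← edgeStep_eq_one_iff]
    omega
  refine ⟨fun x y hxy => (key x y hxy).1, fun x y hxy => ?_⟩
  -- The odd vertex `(x, y)` is the middle of the zigzag that starts at `(x, y - ε₂)`.
  simpa using (key x (y - ε₂) (by rcases h₂ with rfl | rfl <;> grind)).2

/-- Without flips at most one of the two outgoing edges of a vertex is crossed, so that along the
other one the height increases by `1`. -/
theorem exists_ascending (hh : IsHeightFunction t h) (hf : ¬ AdmitsFlip t) (n : ℕ) :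
    ∃ x y : ℤ, Even (x + y) ∧ |x| ≤ n ∧ |y| ≤ n ∧ h (x, y) = 2 * n := by
  induction n with
  | zero => exact ⟨0, 0, by simp, by simp, by simp, by simpa using hh.1⟩
  | succ n ih =>
    obtain ⟨x, y, hxy, hx, hy, e⟩ := ih
    obtain ⟨ε₂, h₂, H₂⟩ : ∃ ε : ℤ, (ε = 1 ∨ ε = -1) ∧ hor (x - 1) (min y (y + ε)) ∉ t := by
      by_contra! H
      have a := H 1 (by simp)
      have b := H (-1) (by simp)
      rw [min_eq_left (by omega)] at a
      rw [min_eq_right (by omega)] at b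
      exact hf ⟨x - 1, y + -1, .inl ⟨b, by simpa using a⟩⟩
    obtain ⟨ε₁, h₁, H₁⟩ : ∃ ε : ℤ, (ε = 1 ∨ ε = -1) ∧
        ver (min x (x + ε)) (y + ε₂ - 1) ∉ t := by
      by_contra! H
      have a := H 1 (by simp)
      have b := H (-1) (by simp)
      rw [min_eq_left (by omega)] at a
      rw [min_eq_right (by omega)] at b
      exact hf ⟨x + -1, y + ε₂ - 1, .inr ⟨b, by simpa using a⟩⟩
    refine ⟨x + ε₁, y + ε₂, by rcases h₁ with rfl | rfl <;> rcases h₂ with rfl | rfl <;> grind,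
      ?_, ?_, ?_⟩
    · rw [abs_le] at hx ⊢; push_cast; omega
    · rw [abs_le] at hy ⊢; push_cast; omega
    · rw [hh.diagonal_step h₁ h₂ hxy, edgeStep_eq_one_iff.2 H₂, edgeStep_eq_one_iff.2 H₁]
      push_cast; omega

end IsHeightFunction

theorem UncrossedTowards.not_admitsFlip {t : Set Domino} {ε₁ ε₂ : ℤ}
    (H : UncrossedTowards t ε₁ ε₂) (h₁ : ε₁ = 1 ∨ ε₁ = -1) (h₂ : ε₂ = 1 ∨ ε₂ = -1) :
    ¬ AdmitsFlip t := by
  -- Of the two crossed edges at the centre `(x + 1, y + 1)` of a flip, which are both incoming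
  -- or both outgoing, one has the direction of `(ε₁, ε₂)`.
  rintro ⟨x, y, ⟨a, b⟩ | ⟨a, b⟩⟩
  · have A := fun z => H.1 (x + 1) z
    simp only [add_sub_cancel_right] at A
    have A0 := A y
    have A1 := A (y + 1)
    have A2 := A (y + 1 + 1)
    rcases h₂ with rfl | rfl
    · rw [min_eq_left (by omega)] at A0 A1
      grind
    · rw [min_eq_right (by omega), add_neg_cancel_right] at A1 A2
      grind
  · have A := fun z => H.2 z (y + 1)
    simp only [add_sub_cancel_right] at A
    have A0 := A x
    have A1 := A (x + 1)
    have A2 := A (x + 1 + 1)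
    rcases h₁ with rfl | rfl
    · rw [min_eq_left (by omega)] at A0 A1
      grind
    · rw [min_eq_right (by omega), add_neg_cancel_right] at A1 A2
      grind

/-! ### The flux and the square -/

/-- The flux takes values at most `1/2` at the vectors `(±1, ±1)`, and if it attains this bound,
then no edge towards that vector is crossed. -/
theorem flux_diagonal_le {L : AddSubgroup (ℤ × ℤ)} (hL : IsValidLattice L) {t : Set Domino}
    {φ : ℝ × ℝ} (hφ : IsFlux L t φ) {ε₁ ε₂ : ℤ} (h₁ : ε₁ = 1 ∨ ε₁ = -1)
    (h₂ : ε₂ = 1 ∨ ε₂ = -1) :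
    φ.1 * ε₁ + φ.2 * ε₂ ≤ 1 / 2 ∧
      (φ.1 * ε₁ + φ.2 * ε₂ = 1 / 2 → UncrossedTowards t ε₁ ε₂) := by
  obtain ⟨h, hh, H⟩ := hφ
  obtain ⟨N, hN, hNL⟩ := hL.exists_mul_mem
  have hN' : (0 : ℝ) < N := by exact_mod_cast hN
  have key (x y : ℤ) : (h (x + N * ε₁, y + N * ε₂) : ℝ) =
      h (x, y) + 4 * N * (φ.1 * ε₁ + φ.2 * ε₂) := by
    have := H _ (hNL ε₁ ε₂) (x, y)
    simp only [Prod.mk_add_mk] at this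
    push_cast at this
    linarith
  constructor
  · have a : (h (0 + N * ε₁, 0 + N * ε₂) : ℝ) ≤ h (0, 0) + 2 * N := by
      exact_mod_cast hh.diagonal_le h₁ h₂ (x := 0) (y := 0) (by simp) N
    rw [key] at a
    by_contra! hlt
    nlinarith
  · refine fun he => hh.uncrossedTowards h₁ h₂ hN fun x y => ?_
    have := key x y
    rw [he] at this
    have : (h (x + N * ε₁, y + N * ε₂) : ℝ) = h (x, y) + 2 * N := by linarith
    exact_mod_cast this

theorem abs_add_abs_eq_sign (a b : ℝ) : ∃ ε₁ ε₂ : ℤ, (ε₁ = 1 ∨ ε₁ = -1) ∧ (ε₂ = 1 ∨ ε₂ = -1) ∧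
    |a| + |b| = a * ε₁ + b * ε₂ := by
  have key (a : ℝ) : ∃ ε : ℤ, (ε = 1 ∨ ε = -1) ∧ |a| = a * ε := by
    rcases abs_choice a with h | h
    · exact ⟨1, by simp, by simpa using h⟩
    · exact ⟨-1, by simp, by simpa using h⟩
  obtain ⟨ε₁, h₁, e₁⟩ := key a
  obtain ⟨ε₂, h₂, e₂⟩ := key b
  exact ⟨ε₁, ε₂, h₁, h₂, by rw [e₁, e₂]⟩

theorem flux_abs_add_abs_le {L : AddSubgroup (ℤ × ℤ)} (hL : IsValidLattice L) {t : Set Domino}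
    {φ : ℝ × ℝ} (hφ : IsFlux L t φ) : |φ.1| + |φ.2| ≤ 1 / 2 := by
  obtain ⟨ε₁, ε₂, h₁, h₂, e⟩ := abs_add_abs_eq_sign φ.1 φ.2
  rw [e]
  exact (flux_diagonal_le hL hφ h₁ h₂).1

/-- The height differs from the linear function given by the flux by a bounded amount, as the
difference is periodic. -/
theorem IsFlux.exists_height_le {L : AddSubgroup (ℤ × ℤ)} (hL : IsValidLattice L)
    {t : Set Domino} {φ : ℝ × ℝ} (hφ : IsFlux L t φ) :
    ∃ h, IsHeightFunction t h ∧ ∃ C : ℝ, ∀ x y : ℤ,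
      (h (x, y) : ℝ) ≤ 4 * (φ.1 * x + φ.2 * y) + C := by
  obtain ⟨h, hh, H⟩ := hφ
  obtain ⟨N, hN, hNL⟩ := hL.exists_mul_mem
  have hN' : (0 : ℤ) < N := by exact_mod_cast hN
  set g : ℤ × ℤ → ℝ := fun p => h p - 4 * (φ.1 * p.1 + φ.2 * p.2) with hg
  have per (x y : ℤ) : g (x, y) = g (x % N, y % N) := by
    have e := H _ (hNL (x / N) (y / N)) (x % N, y % N)
    have ex := Int.emod_add_mul_ediv x N
    have ey := Int.emod_add_mul_ediv y N
    rw [Prod.mk_add_mk, ex, ey] at e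
    have ex' : (x : ℝ) = (x % N : ℤ) + (N * (x / N) : ℤ) := by exact_mod_cast ex.symm
    have ey' : (y : ℝ) = (y % N : ℤ) + (N * (y / N) : ℤ) := by exact_mod_cast ey.symm
    simp only [hg]
    rw [ex', ey']
    linear_combination -4 * e
  obtain ⟨C, hC⟩ := (((Set.finite_Ico (0 : ℤ) N).prod (Set.finite_Ico (0 : ℤ) N)).image g).bddAbove
  refine ⟨h, hh, C, fun x y => ?_⟩
  have := hC ⟨(x % N, y % N), ⟨⟨Int.emod_nonneg _ hN'.ne', Int.emod_lt_of_pos _ hN'⟩,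
    ⟨Int.emod_nonneg _ hN'.ne', Int.emod_lt_of_pos _ hN'⟩⟩, rfl⟩
  rw [← per] at this
  simp only [hg] at this
  linarith

theorem flux_abs_add_abs_ge {L : AddSubgroup (ℤ × ℤ)} (hL : IsValidLattice L) {t : Set Domino}
    {φ : ℝ × ℝ} (hφ : IsFlux L t φ) (hf : ¬ AdmitsFlip t) : 1 / 2 ≤ |φ.1| + |φ.2| := by
  obtain ⟨h, hh, C, hC⟩ := hφ.exists_height_le hL
  by_contra! hlt
  obtain ⟨n, hn⟩ := exists_nat_gt (C / (2 - 4 * (|φ.1| + |φ.2|)))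
  rw [div_lt_iff₀ (by linarith)] at hn
  obtain ⟨x, y, -, hx, hy, e⟩ := hh.exists_ascending hf n
  have hx' : |(x : ℝ)| ≤ n := by exact_mod_cast hx
  have hy' : |(y : ℝ)| ≤ n := by exact_mod_cast hy
  have c := hC x y
  rw [e] at c
  push_cast at c
  have a : φ.1 * x ≤ |φ.1| * n :=
    (le_abs_self _).trans ((abs_mul _ _).trans_le (by gcongr))
  have b : φ.2 * y ≤ |φ.2| * n :=
    (le_abs_self _).trans ((abs_mul _ _).trans_le (by gcongr))
  linarith

theorem mem_frontier_fluxSquare {p : ℝ × ℝ} :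
    p ∈ frontier fluxSquare ↔ |p.1| + |p.2| = 1 / 2 := by
  have hc : Continuous fun p : ℝ × ℝ => |p.1| + |p.2| := by fun_prop
  refine ⟨fun h => frontier_le_subset_eq hc continuous_const h, fun h => ?_⟩
  refine ⟨subset_closure h.le, fun hi => ?_⟩
  -- A point `s • p` with `s > 1` does not belong to the square.
  have hs : Continuous fun s : ℝ => s • p := by fun_prop
  have hev : ∀ᶠ s in nhds (1 : ℝ), s • p ∈ fluxSquare :=
    hs.continuousAt.eventually_mem (by simpa using mem_interior_iff_mem_nhds.1 hi)
  obtain ⟨s, hs, hs1⟩ :=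
    ((hev.filter_mono nhdsWithin_le_nhds).and
      (self_mem_nhdsWithin : Set.Ioi (1 : ℝ) ∈ nhdsWithin 1 (Set.Ioi 1))).exists
  simp only [fluxSquare, Set.mem_ofPred_eq, Prod.smul_fst, Prod.smul_snd, smul_eq_mul, abs_mul,
    ← mul_add, h] at hs
  rw [abs_of_pos (by linarith)] at hs
  linarith

/-! ### Staircases -/

theorem touchAt_hor {x y x' y' : ℤ} {a b : ℤ × ℤ} :
    TouchAt (hor x y) (hor x' y') a b ↔ (a = (x, y) ∨ a = (x + 1, y)) ∧
      (b = (x', y') ∨ b = (x' + 1, y')) ∧ |a.1 - b.1| + |a.2 - b.2| = 1 := by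
  rw [TouchAt, mem_squares_hor, mem_squares_hor]

theorem touchAt_ver {x y x' y' : ℤ} {a b : ℤ × ℤ} :
    TouchAt (ver x y) (ver x' y') a b ↔ (a = (x, y) ∨ a = (x, y + 1)) ∧
      (b = (x', y') ∨ b = (x', y' + 1)) ∧ |a.1 - b.1| + |a.2 - b.2| = 1 := by
  rw [TouchAt, mem_squares_ver, mem_squares_ver]

/-- Two horizontal dominoes that touch along exactly one edge, on the longer side, are diagonal
neighbours. -/
theorem TouchAlongLongerSide.hor_cases {x y x' y' : ℤ}
    (H : TouchAlongLongerSide (hor x y) (hor x' y')) :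
    (y' = y + 1 ∨ y' = y - 1) ∧ (x' = x + 1 ∨ x' = x - 1) := by
  obtain ⟨⟨a1, a2⟩, ⟨b1, b2⟩, H, hs⟩ := H
  have hs : a1 = b1 := hs
  have h := touchAt_hor.1 ((H _ _).2 ⟨rfl, rfl⟩)
  simp only [Prod.mk.injEq] at h
  have hy : y' = y + 1 ∨ y' = y - 1 := by grind
  refine ⟨hy, ?_⟩
  have hx : x' ≠ x := by
    rintro rfl
    have e : |y - y'| = 1 := by grind
    have h1 := (H (x', y) (x', y')).1 (touchAt_hor.2 (by simp [e]))
    have h2 := (H (x' + 1, y) (x' + 1, y')).1 (touchAt_hor.2 (by simp [e]))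
    grind
  grind

theorem TouchAlongLongerSide.ver_cases {x y x' y' : ℤ}
    (H : TouchAlongLongerSide (ver x y) (ver x' y')) :
    (x' = x + 1 ∨ x' = x - 1) ∧ (y' = y + 1 ∨ y' = y - 1) := by
  obtain ⟨⟨a1, a2⟩, ⟨b1, b2⟩, H, hs⟩ := H
  have hs : a2 = b2 := hs
  have h := touchAt_ver.1 ((H _ _).2 ⟨rfl, rfl⟩)
  simp only [Prod.mk.injEq] at h
  have hx : x' = x + 1 ∨ x' = x - 1 := by grind
  refine ⟨hx, ?_⟩
  have hy : y' ≠ y := by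
    rintro rfl
    have e : |x - x'| = 1 := by grind
    have h1 := (H (x, y') (x', y')).1 (touchAt_ver.2 (by simp [e]))
    have h2 := (H (x, y' + 1) (x', y' + 1)).1 (touchAt_ver.2 (by simp [e]))
    grind
  grind

/-- Around each of its dominoes, a staircase is straight: if both neighbours were on the same side,
they would be neighbours of each other, since they touch the domino at different squares. -/
theorem IsStaircase.exists_translate {s : ℤ → Domino} (hs : IsStaircase s) (n : ℤ) :
    ∃ ε₁ ε₂ : ℤ, (ε₁ = 1 ∨ ε₁ = -1) ∧ (ε₂ = 1 ∨ ε₂ = -1) ∧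
      s (n + 1) = (s n).translate (ε₁, ε₂) ∧ s (n - 1) = (s n).translate (-ε₁, -ε₂) := by
  have t1 := hs.longer_side n (n + 1) ((hs.neighbours _ _).2 (by simp))
  have t2 := hs.longer_side n (n - 1) ((hs.neighbours _ _).2 (by simp))
  have o1 := hs.same_orientation n (n + 1)
  have o2 := hs.same_orientation n (n - 1)
  have ds := hs.different_squares n
  have nb : ¬ Neighbouring (s (n + 1)) (s (n - 1)) := by
    rw [hs.neighbours]; omega
  generalize s (n + 1) = e at *
  generalize s (n - 1) = f at *
  generalize s n = d at *
  obtain ⟨⟨x, y⟩, o⟩ := d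
  obtain ⟨⟨x', y'⟩, o'⟩ := e
  obtain ⟨⟨x'', y''⟩, o''⟩ := f
  dsimp only at o1 o2
  subst o1 o2
  refine ⟨x' - x, y' - y, ?_⟩
  simp only [Domino.translate, Prod.mk_add_mk, Domino.mk.injEq, Prod.mk.injEq, and_true]
  cases o
  · change TouchAlongLongerSide (ver x y) (ver x' y') at t1
    change TouchAlongLongerSide (ver x y) (ver x'' y'') at t2
    change ∀ a b a' b' : ℤ × ℤ, TouchAt (ver x y) (ver x' y') a b →
      TouchAt (ver x y) (ver x'' y'') a' b' → a ≠ a' at ds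
    change ¬ Neighbouring (ver x' y') (ver x'' y'') at nb
    obtain ⟨hx', hy'⟩ := t1.ver_cases
    obtain ⟨hx'', hy''⟩ := t2.ver_cases
    have hy : y'' ≠ y' := by
      rintro rfl
      obtain ⟨z, h0, h1⟩ : ∃ z, (z = y ∨ z = y + 1) ∧ (z = y'' ∨ z = y'' + 1) := by
        rcases hy' with rfl | rfl
        · exact ⟨y + 1, by simp⟩
        · exact ⟨y, by simp⟩
      refine ds (x, z) (x', z) (x, z) (x'', z) (touchAt_ver.2 ?_) (touchAt_ver.2 ?_) rfl
      · simp only [Prod.mk.injEq, true_and, sub_self, abs_zero]; grind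
      · simp only [Prod.mk.injEq, true_and, sub_self, abs_zero]; grind
    have hx : x'' ≠ x' := by
      rintro rfl
      refine nb ⟨by simp [ver_inj, hy.symm], ?_⟩
      rcases hy' with rfl | rfl
      · refine ⟨(x'', y + 1), (x'', y), touchAt_ver.2 ?_⟩
        simp only [Prod.mk.injEq, true_and, sub_self, abs_zero]; grind
      · refine ⟨(x'', y), (x'', y + 1), touchAt_ver.2 ?_⟩
        simp only [Prod.mk.injEq, true_and, sub_self, abs_zero]; grind
    omega
  · change TouchAlongLongerSide (hor x y) (hor x' y') at t1
    change TouchAlongLongerSide (hor x y) (hor x'' y'') at t2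
    change ∀ a b a' b' : ℤ × ℤ, TouchAt (hor x y) (hor x' y') a b →
      TouchAt (hor x y) (hor x'' y'') a' b' → a ≠ a' at ds
    change ¬ Neighbouring (hor x' y') (hor x'' y'') at nb
    obtain ⟨hy', hx'⟩ := t1.hor_cases
    obtain ⟨hy'', hx''⟩ := t2.hor_cases
    have hx : x'' ≠ x' := by
      rintro rfl
      obtain ⟨z, h0, h1⟩ : ∃ z, (z = x ∨ z = x + 1) ∧ (z = x'' ∨ z = x'' + 1) := by
        rcases hx' with rfl | rfl
        · exact ⟨x + 1, by simp⟩
        · exact ⟨x, by simp⟩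
      refine ds (z, y) (z, y') (z, y) (z, y'') (touchAt_hor.2 ?_) (touchAt_hor.2 ?_) rfl
      · simp only [Prod.mk.injEq, and_true, sub_self, abs_zero]; grind
      · simp only [Prod.mk.injEq, and_true, sub_self, abs_zero]; grind
    have hy : y'' ≠ y' := by
      rintro rfl
      refine nb ⟨by simp [hor_inj, hx.symm], ?_⟩
      rcases hx' with rfl | rfl
      · refine ⟨(x + 1, y''), (x, y''), touchAt_hor.2 ?_⟩
        simp only [Prod.mk.injEq, and_true, sub_self, abs_zero]; grind
      · refine ⟨(x, y''), (x + 1, y''), touchAt_hor.2 ?_⟩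
        simp only [Prod.mk.injEq, and_true, sub_self, abs_zero]; grind
    omega

/-- In a tiling by staircases, the two diagonal neighbours of a domino in its staircase obstruct
a flip on either side of it. -/
theorem ConsistsOfParallelStaircases.not_admitsFlip {t : Set Domino} (ht : IsTiling t)
    (H : ConsistsOfParallelStaircases t) : ¬ AdmitsFlip t := by
  obtain ⟨S, hS, -, hc⟩ := H
  have key (d : Domino) (hd : d ∈ t) : ∃ ε₁ ε₂ : ℤ, (ε₁ = 1 ∨ ε₁ = -1) ∧ (ε₂ = 1 ∨ ε₂ = -1) ∧
      d.translate (ε₁, ε₂) ∈ t ∧ d.translate (-ε₁, -ε₂) ∈ t := by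
    obtain ⟨s, hs, n, rfl⟩ := hc d hd
    obtain ⟨ε₁, ε₂, h₁, h₂, e, f⟩ := (hS s hs).1.exists_translate n
    exact ⟨ε₁, ε₂, h₁, h₂, e ▸ (hS s hs).2 _, f ▸ (hS s hs).2 _⟩
  rintro ⟨x, y, ⟨a, b⟩ | ⟨a, b⟩⟩
  · obtain ⟨ε₁, ε₂, h₁, h₂, h, h'⟩ := key _ a
    rw [translate_hor] at h h'
    dsimp only at h h'
    have A := fun z (hz : hor z (y + 1) ∈ t) => ht.not_hor_hor b hz
    have B := fun z (hz : hor z (y + 1) ∈ t) => ht.not_hor_hor hz b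
    rcases h₂ with rfl | rfl
    · have := A _ h; have := B _ h; omega
    · rw [neg_neg] at h'; have := A _ h'; have := B _ h'; omega
  · obtain ⟨ε₁, ε₂, h₁, h₂, h, h'⟩ := key _ a
    rw [translate_ver] at h h'
    dsimp only at h h'
    have A := fun z (hz : ver (x + 1) z ∈ t) => ht.not_ver_ver b hz
    have B := fun z (hz : ver (x + 1) z ∈ t) => ht.not_ver_ver hz b
    rcases h₁ with rfl | rfl
    · have := A _ h; have := B _ h; omega
    · rw [neg_neg] at h'; have := A _ h'; have := B _ h'; omega

theorem touchAt_hor_diagonal {x y δ₁ δ₂ : ℤ} (h₁ : δ₁ = 1 ∨ δ₁ = -1) (h₂ : δ₂ = 1 ∨ δ₂ = -1)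
    (a b : ℤ × ℤ) : TouchAt (hor x y) (hor (x + δ₁) (y + δ₂)) a b ↔
      a = (max x (x + δ₁), y) ∧ b = (max x (x + δ₁), y + δ₂) := by
  obtain ⟨a1, a2⟩ := a
  obtain ⟨b1, b2⟩ := b
  rw [touchAt_hor]
  simp only [Prod.mk.injEq]
  rcases h₁ with rfl | rfl <;> rcases h₂ with rfl | rfl <;> grind

theorem touchAt_ver_diagonal {x y δ₁ δ₂ : ℤ} (h₁ : δ₁ = 1 ∨ δ₁ = -1) (h₂ : δ₂ = 1 ∨ δ₂ = -1)
    (a b : ℤ × ℤ) : TouchAt (ver x y) (ver (x + δ₁) (y + δ₂)) a b ↔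
      a = (x, max y (y + δ₂)) ∧ b = (x + δ₁, max y (y + δ₂)) := by
  obtain ⟨a1, a2⟩ := a
  obtain ⟨b1, b2⟩ := b
  rw [touchAt_ver]
  simp only [Prod.mk.injEq]
  rcases h₁ with rfl | rfl <;> rcases h₂ with rfl | rfl <;> grind

theorem touchAlongLongerSide_translate (d : Domino) {δ₁ δ₂ : ℤ} (h₁ : δ₁ = 1 ∨ δ₁ = -1)
    (h₂ : δ₂ = 1 ∨ δ₂ = -1) : TouchAlongLongerSide d (d.translate (δ₁, δ₂)) := by
  obtain ⟨⟨x, y⟩, _ | _⟩ := d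
  · exact ⟨_, _, touchAt_ver_diagonal h₁ h₂, rfl⟩
  · exact ⟨_, _, touchAt_hor_diagonal h₁ h₂, rfl⟩

theorem neighbouring_translate (d : Domino) {δ₁ δ₂ : ℤ} (h₁ : δ₁ = 1 ∨ δ₁ = -1)
    (h₂ : δ₂ = 1 ∨ δ₂ = -1) : Neighbouring d (d.translate (δ₁, δ₂)) := by
  obtain ⟨a, b, H, -⟩ := touchAlongLongerSide_translate d h₁ h₂
  refine ⟨fun e => ?_, a, b, (H a b).2 ⟨rfl, rfl⟩⟩
  have := congrArg (fun d : Domino => d.corner.1) e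
  simp only [Domino.translate, Prod.fst_add] at this
  omega

/-- The translates of a domino by the multiples of `(ε₁, ε₂)` form a staircase. -/
theorem isStaircase_translate (d : Domino) {ε₁ ε₂ : ℤ} (h₁ : ε₁ = 1 ∨ ε₁ = -1)
    (h₂ : ε₂ = 1 ∨ ε₂ = -1) : IsStaircase fun n => d.translate (n * ε₁, n * ε₂) := by
  have nb (m n : ℤ) (H : Neighbouring (d.translate (m * ε₁, m * ε₂))
      (d.translate (n * ε₁, n * ε₂))) : n = m + 1 ∨ n = m - 1 := by
    obtain ⟨hne, a, b, hab⟩ := H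
    have hmn : m ≠ n := by rintro rfl; exact hne rfl
    rcases d.eq_hor_or_ver with h | h
    · rw [h, translate_hor, translate_hor, touchAt_hor] at hab
      rcases h₁ with rfl | rfl <;> rcases h₂ with rfl | rfl <;> grind
    · rw [h, translate_ver, translate_ver, touchAt_ver] at hab
      rcases h₁ with rfl | rfl <;> rcases h₂ with rfl | rfl <;> grind
  have next (m : ℤ) : d.translate ((m + 1) * ε₁, (m + 1) * ε₂) =
      (d.translate (m * ε₁, m * ε₂)).translate (ε₁, ε₂) := by
    ext <;> simp [Domino.translate] <;> ring
  have prev (m : ℤ) : d.translate ((m - 1) * ε₁, (m - 1) * ε₂) =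
      (d.translate (m * ε₁, m * ε₂)).translate (-ε₁, -ε₂) := by
    ext <;> simp [Domino.translate] <;> ring
  have h₁' : -ε₁ = 1 ∨ -ε₁ = -1 := by omega
  have h₂' : -ε₂ = 1 ∨ -ε₂ = -1 := by omega
  refine ⟨fun _ _ => rfl, fun m n => ⟨nb m n, ?_⟩, fun m n H => ?_, fun n a b a' b' => ?_⟩
  · rintro (rfl | rfl)
    · rw [next]; exact neighbouring_translate _ h₁ h₂
    · rw [prev]; exact neighbouring_translate _ h₁' h₂'
  · rcases nb m n H with rfl | rfl
    · rw [next]; exact touchAlongLongerSide_translate _ h₁ h₂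
    · rw [prev]; exact touchAlongLongerSide_translate _ h₁' h₂'
  · rw [next, prev]
    generalize d.translate (n * ε₁, n * ε₂) = e
    rcases e.eq_hor_or_ver with h | h
    · rw [h, translate_hor, translate_hor, touchAt_hor_diagonal h₁ h₂,
        touchAt_hor_diagonal h₁' h₂']
      rintro ⟨rfl, -⟩ ⟨rfl, -⟩
      simp only [ne_eq, Prod.mk.injEq, and_true]
      omega
    · rw [h, translate_ver, translate_ver, touchAt_ver_diagonal h₁ h₂,
        touchAt_ver_diagonal h₁' h₂']
      rintro ⟨rfl, -⟩ ⟨rfl, -⟩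
      simp only [ne_eq, Prod.mk.injEq, true_and]
      omega

/-- If no edge towards `(ε₁, ε₂)` is crossed, the colour of a square leaves only two possibilities
for the domino that covers it, one horizontal and one vertical. For the square of
`d.translate (±(ε₁, ε₂))` that touches `d`, the domino not parallel to `d` would overlap `d`, and
the other one is the translate of `d`. -/
theorem UncrossedTowards.translate_mem {t : Set Domino} (ht : IsTiling t) {ε₁ ε₂ : ℤ}
    (H : UncrossedTowards t ε₁ ε₂) (h₁ : ε₁ = 1 ∨ ε₁ = -1) (h₂ : ε₂ = 1 ∨ ε₂ = -1)
    {d : Domino} (hd : d ∈ t) :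
    d.translate (ε₁, ε₂) ∈ t ∧ d.translate (-ε₁, -ε₂) ∈ t := by
  have hH (x y : ℤ) (h : hor x y ∈ t) : (ε₂ = 1 ↔ Even (x + y)) := by
    have := fun z => H.1 (x + 1) z
    simp only [add_sub_cancel_right] at this
    rcases h₂ with rfl | rfl
    · have := this y
      rw [min_eq_left (by omega)] at this
      grind
    · have := this (y + 1)
      rw [min_eq_right (by omega), add_neg_cancel_right] at this
      grind
  have hV (x y : ℤ) (h : ver x y ∈ t) : (ε₁ = 1 ↔ ¬ Even (x + y)) := by
    have := fun z => H.2 z (y + 1)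
    simp only [add_sub_cancel_right] at this
    rcases h₁ with rfl | rfl
    · have := this x
      rw [min_eq_left (by omega)] at this
      grind
    · have := this (x + 1)
      rw [min_eq_right (by omega), add_neg_cancel_right] at this
      grind
  have key (δ₁ δ₂ : ℤ) (hδ : δ₁ = ε₁ ∧ δ₂ = ε₂ ∨ δ₁ = -ε₁ ∧ δ₂ = -ε₂) :
      d.translate (δ₁, δ₂) ∈ t := by
    have hδ₁ : δ₁ = 1 ∨ δ₁ = -1 := by omega
    have hδ₂ : δ₂ = 1 ∨ δ₂ = -1 := by omega
    rcases d.eq_hor_or_ver with e | e <;> rw [e] at hd ⊢ <;>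
      generalize d.corner.1 = x at * <;> generalize d.corner.2 = y at *
    · rw [translate_hor]
      have p := hH x y hd
      have c := ht.cover (max x (x + δ₁)) (y + δ₂)
      have o (z : ℤ) (hz : ver (max x (x + δ₁)) z ∈ t) := ht.not_hor_ver hd hz
      have pH (z : ℤ) := hH z (y + δ₂)
      have pV (z : ℤ) := hV (max x (x + δ₁)) z
      rcases hδ₁ with rfl | rfl <;> rcases hδ₂ with rfl | rfl <;> grind
    · rw [translate_ver]
      have p := hV x y hd
      have c := ht.cover (x + δ₁) (max y (y + δ₂))
      have o (z : ℤ) (hz : hor z (max y (y + δ₂)) ∈ t) := ht.not_hor_ver hz hd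
      have pV (z : ℤ) := hV (x + δ₁) z
      have pH (z : ℤ) := hH z (max y (y + δ₂))
      rcases hδ₁ with rfl | rfl <;> rcases hδ₂ with rfl | rfl <;> grind
  exact ⟨key _ _ (by simp), key _ _ (by simp)⟩

theorem UncrossedTowards.consistsOfParallelStaircases {t : Set Domino} (ht : IsTiling t)
    {ε₁ ε₂ : ℤ} (H : UncrossedTowards t ε₁ ε₂) (h₁ : ε₁ = 1 ∨ ε₁ = -1)
    (h₂ : ε₂ = 1 ∨ ε₂ = -1) : ConsistsOfParallelStaircases t := by
  have mem (d : Domino) (hd : d ∈ t) (n : ℤ) : d.translate (n * ε₁, n * ε₂) ∈ t := by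
    induction n using Int.induction_on with
    | zero => simpa [translate_zero] using hd
    | succ n ih =>
      convert (H.translate_mem ht h₁ h₂ ih).1 using 1
      ext <;> simp [Domino.translate] <;> ring
    | pred n ih =>
      convert (H.translate_mem ht h₁ h₂ ih).2 using 1
      ext <;> simp [Domino.translate] <;> ring
  refine ⟨{s | ∃ d ∈ t, s = fun n => d.translate (n * ε₁, n * ε₂)}, ?_, ?_, fun d hd => ?_⟩
  · rintro _ ⟨d, hd, rfl⟩
    exact ⟨isStaircase_translate d h₁ h₂, mem d hd⟩
  · rintro _ ⟨d, -, rfl⟩ _ ⟨e, -, rfl⟩ m n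
    simp only [Domino.translate, Prod.fst_add, Prod.snd_add]
    ring
  · exact ⟨_, ⟨d, hd, rfl⟩, 0, by simp [translate_zero]⟩

/-! ### The equivalence -/

theorem mainTheorem4 (L : AddSubgroup (ℤ × ℤ)) (hL : IsValidLattice L)
    (t : Set Domino) (ht : IsTorusTiling L t) :
    (∃! φ : ℝ × ℝ, IsFlux L t φ) ∧
    ∀ φ : ℝ × ℝ, IsFlux L t φ →
      (¬ AdmitsFlip t ↔ φ ∈ frontier fluxSquare) ∧
      (¬ AdmitsFlip t ↔ ConsistsOfParallelStaircases t) := by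
  refine ⟨existsUnique_isFlux hL ht, fun φ hφ => ?_⟩
  have abs_add_abs_eq : ¬ AdmitsFlip t → |φ.1| + |φ.2| = 1 / 2 := fun hf =>
    le_antisymm (flux_abs_add_abs_le hL hφ) (flux_abs_add_abs_ge hL hφ hf)
  have uncrossed : |φ.1| + |φ.2| = 1 / 2 → ∃ ε₁ ε₂ : ℤ, (ε₁ = 1 ∨ ε₁ = -1) ∧
      (ε₂ = 1 ∨ ε₂ = -1) ∧ UncrossedTowards t ε₁ ε₂ := by
    intro h
    obtain ⟨ε₁, ε₂, h₁, h₂, e⟩ := abs_add_abs_eq_sign φ.1 φ.2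
    exact ⟨ε₁, ε₂, h₁, h₂, (flux_diagonal_le hL hφ h₁ h₂).2 (e.symm.trans h)⟩
  rw [mem_frontier_fluxSquare]
  refine ⟨⟨abs_add_abs_eq, fun h => ?_⟩, fun hf => ?_, fun h => h.not_admitsFlip ht.1⟩
  · obtain ⟨ε₁, ε₂, h₁, h₂, H⟩ := uncrossed h
    exact H.not_admitsFlip h₁ h₂
  · obtain ⟨ε₁, ε₂, h₁, h₂, H⟩ := uncrossed (abs_add_abs_eq hf)
    exact H.consistsOfParallelStaircases ht.1 h₁ h₂
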